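/- Let $\hbar>0$, let $\kappa$ be a Borel probability measure on $\mathbb R$, and let $X$ be the position operator on $L^2(\mathbb R)$ (so $e^{ipX/\hbar}$ is multiplication by $x\mapsto e^{ipx/\hbar}$). Define the position-dephasing channel $$\Delta_g(\rho)=\int_{\mathbb R} e^{\frac{i}{\hbar}pX}\,\rho\,e^{-\frac{i}{\hbar}pX}\,d\kappa(p),\qquad g(\xi)=\int_{\mathbb R}e^{\frac{i}{\hbar}p\xi}\,d\kappa(p),$$ so that $\Delta_g$ multiplies the position kernel $\rho(x,y)$ by $g(x-y)$. A normal state is a positive trace-class operator $\rho$ on $L^2(\mathbb R)$ with $\operatorname{Tr}\rho=1$. For normal states $\rho=\sum_a aP_a$ and $\sigma=\sum_b bQ_b$ (spectral decompositions) let $$S(\rho\Vert\sigma)=\operatorname{Tr}\big(\rho(\ln\rho-\ln\sigma)\big)=\sum_{a,b}\operatorname{Tr}(P_aQ_b)\,a(\ln a-\ln b)\in(-\infty,+\infty]$$ be the quantum relative entropy (with $0(\ln 0-\ln b)=0$ and $a(\ln a-\ln 0)=+\infty$ for $a>0$; the negative part of the sum is finite), and let $C_{\mathrm{rel}}^{g}(\rho)=S(\rho\Vert\Delta_g(\rho))$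 be the relative-entropy $g$-dephasing loss. Then $C_{\mathrm{rel}}^{g}(\rho)\ge 0$ for every normal state $\rho$. Furthermore, if $|g(\xi)|<1$ for all $\xi\neq 0$, then no normal state $\rho$ satisfies $C_{\mathrm{rel}}^{g}(\rho)=0$. -/

import Mathlib

open MeasureTheory Filter Topology
open scoped ENNReal InnerProductSpace

noncomputable section

namespace QuantumCoherence

/-! ### Trace of positive operators, density operators, relative entropy -/

/-- Parseval's identity. -/
theorem tsum_inner_sq {H : Type*} [NormedAddCommGroup H] [InnerProductSpace ℂ H] {ι : Type*}
    (b : HilbertBasis ι ℂ H) (x : H) :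
    ∑' i, ENNReal.ofReal (‖⟪b i, x⟫_ℂ‖ ^ 2) = ENNReal.ofReal (‖x‖ ^ 2) := by
  have h := b.hasSum_inner_mul_inner x x
  have h2 : HasSum (fun i => ‖⟪b i, x⟫_ℂ‖ ^ 2) (‖x‖ ^ 2) := by
    have h3 := Complex.hasSum_re h
    convert h3 using 1
    · funext i
      rw [← inner_conj_symm x (b i), ← Complex.normSq_eq_norm_sq, mul_comm, Complex.mul_conj]
      simp
    · rw [← RCLike.re_to_complex, inner_self_eq_norm_sq (𝕜 := ℂ)]
  rw [← ENNReal.ofReal_tsum_of_nonneg (fun i => by positivity) h2.summable, h2.tsum_eq]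

section Hilbert

variable {H : Type*} [NormedAddCommGroup H] [InnerProductSpace ℂ H] [CompleteSpace H]

/-- An index set of a Hilbert basis (a complete orthonormal system) of `H`. -/
def basisIndex (H : Type*) [NormedAddCommGroup H] [InnerProductSpace ℂ H] [CompleteSpace H] :
    Set H :=
  (exists_hilbertBasis ℂ H).choose

/-- A Hilbert basis (a complete orthonormal system) of `H`. -/
def someBasis (H : Type*) [NormedAddCommGroup H] [InnerProductSpace ℂ H] [CompleteSpace H] :
    HilbertBasis (basisIndex H) ℂ H :=
  (exists_hilbertBasis ℂ H).choose_spec.choose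

/-- The trace `∑ᵢ ⟨bᵢ, T bᵢ⟩ ∈ [0, ∞]` of a positive operator `T`, computed in some Hilbert
basis; `posTrace_eq` shows that the basis does not matter. -/
def posTrace (T : H →L[ℂ] H) : ℝ≥0∞ :=
  ∑' i, ENNReal.ofReal (⟪someBasis H i, T (someBasis H i)⟫_ℂ).re

/-- The trace of a positive operator may be computed in any Hilbert basis. -/
theorem posTrace_eq {ι : Type*} (b : HilbertBasis ι ℂ H) {T : H →L[ℂ] H} (hT : T.IsPositive) :
    posTrace T = ∑' i, ENNReal.ofReal (⟪b i, T (b i)⟫_ℂ).re := by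
  obtain ⟨S, hS, hST⟩ : ∃ S : H →L[ℂ] H, IsSelfAdjoint S ∧ S * S = T := by
    have hT0 : 0 ≤ T := T.nonneg_iff_isPositive.2 hT
    exact ⟨CFC.sqrt T, (CFC.sqrt_nonneg T).isSelfAdjoint, CFC.sqrt_mul_sqrt_self T hT0⟩
  have hsym : ∀ x y : H, ⟪S x, y⟫_ℂ = ⟪x, S y⟫_ℂ := fun x y => hS.isSymmetric x y
  have key : ∀ x : H, (⟪x, T x⟫_ℂ).re = ‖S x‖ ^ 2 := by
    intro x
    rw [← hST, show (S * S) x = S (S x) from rfl, ← hsym, ← RCLike.re_to_complex,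
      inner_self_eq_norm_sq (𝕜 := ℂ)]
  simp only [posTrace, key]
  calc ∑' i, ENNReal.ofReal (‖S (someBasis H i)‖ ^ 2)
      = ∑' i, ∑' j, ENNReal.ofReal (‖⟪b j, S (someBasis H i)⟫_ℂ‖ ^ 2) := by
        simp only [tsum_inner_sq]
    _ = ∑' j, ∑' i, ENNReal.ofReal (‖⟪b j, S (someBasis H i)⟫_ℂ‖ ^ 2) := ENNReal.tsum_comm
    _ = ∑' j, ∑' i, ENNReal.ofReal (‖⟪someBasis H i, S (b j)⟫_ℂ‖ ^ 2) := by
        simp only [← hsym, norm_inner_symm]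
    _ = ∑' j, ENNReal.ofReal (‖S (b j)‖ ^ 2) := by
        simp only [tsum_inner_sq]

/-- A normal state (density operator): a positive operator of trace one. A positive operator is
trace class exactly when its trace is finite, so it is in particular trace class. -/
def IsNormalState (ρ : H →L[ℂ] H) : Prop :=
  ρ.IsPositive ∧ posTrace ρ = 1

/-- The spectral projection of `T` at `a`: the orthogonal projection onto `ker (T - a)`, which is
zero unless `a` is an eigenvalue of `T`. -/
def eigenProj (T : H →L[ℂ] H) (a : ℝ) : H →L[ℂ] H :=
  (T - (a : ℂ) • ContinuousLinearMap.id ℂ H).ker.starProjection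

/-- `Tr (P_a Q_b)`, where `P_a` and `Q_b` are the spectral projections of `ρ` at `a` and of `σ`
at `b`, written as the trace of the positive operator `P_a Q_b P_a`. -/
def spectralOverlap (ρ σ : H →L[ℂ] H) (a b : ℝ) : ℝ≥0∞ :=
  posTrace (eigenProj ρ a ∘L eigenProj σ b ∘L eigenProj ρ a)

/-- `a (ln a - ln b)` for `a, b ≥ 0`, with the conventions `0 (ln 0 - ln b) = 0` and
`a (ln a - ln 0) = +∞` for `a > 0`. -/
def entropyTerm (a b : ℝ) : EReal :=
  if a = 0 then 0 else if b = 0 then ⊤ else ((a * (Real.log a - Real.log b) : ℝ) : EReal)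

/-- The quantum relative entropy `S(ρ‖σ) = Tr (ρ (ln ρ - ln σ))` of two normal states. With the
spectral decompositions `ρ = ∑ₐ a P_a` and `σ = ∑_b b Q_b`, this trace is
`∑_{a, b} Tr (P_a Q_b) a (ln a - ln b)`, the sum of the positive parts minus the sum of the negative
parts (the latter is finite, at most `Tr σ`). The value is `+∞` in particular if the support of `ρ`
is not contained in that of `σ`. -/
def relativeEntropy (ρ σ : H →L[ℂ] H) : EReal :=
  ((∑' (a : ℝ) (b : ℝ), spectralOverlap ρ σ a b * (entropyTerm a b).toENNReal : ℝ≥0∞) : EReal) -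
    ((∑' (a : ℝ) (b : ℝ), spectralOverlap ρ σ a b * (-entropyTerm a b).toENNReal : ℝ≥0∞) : EReal)

end Hilbert

/-! ### Position dephasing by random momentum kicks on `L²(ℝ)` -/

/-- The Hilbert space `L²(ℝ)` of complex square-integrable wave functions. -/
abbrev L2R : Type := Lp ℂ 2 (volume : Measure ℝ)

/-- The phase `e^{i p x / ħ}`. -/
def phase (ħ p x : ℝ) : ℂ := Complex.exp (((p * x / ħ : ℝ) : ℂ) * Complex.I)

theorem norm_phase (ħ p x : ℝ) : ‖phase ħ p x‖ = 1 := Complex.norm_exp_ofReal_mul_I _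

theorem memLp_phase_mul (ħ p : ℝ) (ψ : L2R) :
    MemLp (fun x => phase ħ p x * ψ x) 2 (volume : Measure ℝ) := by
  refine (Lp.memLp ψ).of_le ?_ (Eventually.of_forall fun x => by simp [norm_phase])
  refine AEStronglyMeasurable.mul ?_ (Lp.aestronglyMeasurable ψ)
  exact Continuous.aestronglyMeasurable (by unfold phase; fun_prop)

/-- The unitary `e^{i p X / ħ}` on `L²(ℝ)`, where `X` is the position operator:
multiplication of wave functions by `x ↦ e^{i p x / ħ}`. -/
def momentumKick (ħ p : ℝ) : L2R →ₗᵢ[ℂ] L2R where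
  toFun ψ := (memLp_phase_mul ħ p ψ).toLp _
  map_add' ψ φ := by
    rw [← MemLp.toLp_add]
    apply MemLp.toLp_congr
    filter_upwards [Lp.coeFn_add ψ φ] with x hx
    rw [hx, Pi.add_apply, Pi.add_apply, mul_add]
  map_smul' c ψ := by
    rw [RingHom.id_apply, ← MemLp.toLp_const_smul]
    apply MemLp.toLp_congr
    filter_upwards [Lp.coeFn_smul c ψ] with x hx
    rw [hx, Pi.smul_apply, Pi.smul_apply, smul_eq_mul, smul_eq_mul, mul_left_comm]
  norm_map' ψ := by
    change ‖(memLp_phase_mul ħ p ψ).toLp _‖ = ‖ψ‖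
    rw [Lp.norm_toLp, Lp.norm_def]
    congr 1
    exact eLpNorm_congr_norm_ae (Eventually.of_forall fun x => by simp [norm_phase])

theorem momentumKick_coeFn (ħ p : ℝ) (ψ : L2R) :
    momentumKick ħ p ψ =ᵐ[volume] fun x => phase ħ p x * ψ x :=
  MemLp.coeFn_toLp (memLp_phase_mul ħ p ψ)

theorem continuous_momentumKick (ħ : ℝ) (ψ : L2R) : Continuous fun p => momentumKick ħ p ψ := by
  rw [continuous_iff_continuousAt]
  intro q
  rw [ContinuousAt, Lp.tendsto_Lp_iff_tendsto_eLpNorm']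
  have h1 : ∀ p, eLpNorm (⇑(momentumKick ħ p ψ) - ⇑(momentumKick ħ q ψ)) 2 volume =
      (∫⁻ x, ‖(phase ħ p x - phase ħ q x) * ψ x‖ₑ ^ (2 : ℝ)) ^ (1 / (2 : ℝ)) := by
    intro p
    rw [eLpNorm_congr_ae (g := fun x => (phase ħ p x - phase ħ q x) * ψ x),
      eLpNorm_eq_lintegral_rpow_enorm_toReal (by norm_num) (by norm_num)]
    · simp
    · filter_upwards [momentumKick_coeFn ħ p ψ, momentumKick_coeFn ħ q ψ] with x h h'
      simp [h, h', sub_mul]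
  simp only [h1]
  have h2 : Tendsto (fun p => ∫⁻ x, ‖(phase ħ p x - phase ħ q x) * ψ x‖ₑ ^ (2 : ℝ)) (𝓝 q)
      (𝓝 (∫⁻ _ : ℝ, 0)) := by
    refine tendsto_lintegral_filter_of_dominated_convergence
      (fun x => (2 * ‖ψ x‖ₑ) ^ (2 : ℝ)) ?_ ?_ ?_ ?_
    · refine Eventually.of_forall fun p => ?_
      have hm : Measurable (ψ : ℝ → ℂ) := (Lp.stronglyMeasurable ψ).measurable
      have hp : ∀ r, Measurable (phase ħ r) := fun r =>
        Continuous.measurable (by unfold phase; fun_prop)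
      exact ((((hp p).sub (hp q)).mul hm).enorm).pow_const _
    · refine Eventually.of_forall fun p => Eventually.of_forall fun x => ?_
      rw [enorm_mul]
      gcongr
      refine (enorm_sub_le).trans ?_
      have : ∀ r, ‖phase ħ r x‖ₑ = 1 := fun r => by
        rw [← ofReal_norm, norm_phase, ENNReal.ofReal_one]
      rw [this, this]; norm_num
    · have h := (Lp.memLp ψ).2
      have h3 := lintegral_rpow_enorm_lt_top_of_eLpNorm_lt_top (by norm_num) (by norm_num) h
      simp only [ENNReal.mul_rpow_of_nonneg _ _ (zero_le_two : (0 : ℝ) ≤ 2)]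
      rw [lintegral_const_mul' _ _ (by finiteness)]
      exact ENNReal.mul_ne_top (by finiteness) (by simpa using h3.ne)
    · refine Eventually.of_forall fun x => ?_
      have hc : Continuous fun p => ‖(phase ħ p x - phase ħ q x) * ψ x‖ₑ ^ (2 : ℝ) := by
        have : Continuous fun p => phase ħ p x := by unfold phase; fun_prop
        refine (ENNReal.continuous_rpow_const).comp ?_
        fun_prop
      simpa using hc.tendsto q
  have h4 := (ENNReal.continuous_rpow_const (y := 1 / (2 : ℝ))).tendsto _ |>.comp h2
  simpa [Function.comp_def] using h4

/-- The path `p ↦ e^{i p X / ħ} T e^{- i p X / ħ} ψ` is continuous. -/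
theorem continuous_kicked (ħ : ℝ) (T : L2R →L[ℂ] L2R) (ψ : L2R) :
    Continuous fun p => momentumKick ħ p (T (momentumKick ħ (-p) ψ)) := by
  have hv : Continuous fun p => T (momentumKick ħ (-p) ψ) :=
    T.continuous.comp ((continuous_momentumKick ħ ψ).comp continuous_neg)
  rw [continuous_iff_continuousAt]
  intro q
  have h1 := (continuous_momentumKick ħ (T (momentumKick ħ (-q) ψ))).tendsto q
  have h2 : Tendsto (fun p => momentumKick ħ p
      (T (momentumKick ħ (-p) ψ) - T (momentumKick ħ (-q) ψ))) (𝓝 q) (𝓝 0) := by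
    rw [tendsto_zero_iff_norm_tendsto_zero]
    simp only [LinearIsometry.norm_map]
    rw [← tendsto_zero_iff_norm_tendsto_zero]
    simpa using (hv.tendsto q).sub_const (T (momentumKick ħ (-q) ψ))
  have h3 := h2.add h1
  simpa [ContinuousAt] using h3

theorem integrable_kicked (ħ : ℝ) (κ : Measure ℝ) [IsProbabilityMeasure κ]
    (T : L2R →L[ℂ] L2R) (ψ : L2R) :
    Integrable (fun p => momentumKick ħ p (T (momentumKick ħ (-p) ψ))) κ := by
  refine Integrable.of_bound (continuous_kicked ħ T ψ).aestronglyMeasurable (‖T‖ * ‖ψ‖)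
    (Eventually.of_forall fun p => ?_)
  rw [LinearIsometry.norm_map]
  exact (T.le_opNorm _).trans (by rw [LinearIsometry.norm_map])

/-- The position-dephasing channel
`Δ(T) = ∫ e^{i p X / ħ} T e^{- i p X / ħ} dκ(p)`
of random momentum kicks `p` with distribution `κ` (the integral is taken in the strong operator
topology). -/
def dephasing (ħ : ℝ) (κ : Measure ℝ) [IsProbabilityMeasure κ] (T : L2R →L[ℂ] L2R) :
    L2R →L[ℂ] L2R :=
  LinearMap.mkContinuous
    { toFun := fun ψ => ∫ p, momentumKick ħ p (T (momentumKick ħ (-p) ψ)) ∂κ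
      map_add' := fun ψ φ => by
        simp only [map_add]
        exact integral_add (integrable_kicked ħ κ T ψ) (integrable_kicked ħ κ T φ)
      map_smul' := fun c ψ => by
        simp only [map_smul, RingHom.id_apply]
        exact integral_smul c _ }
    ‖T‖ (fun ψ => by
      refine (norm_integral_le_of_norm_le_const (C := ‖T‖ * ‖ψ‖)
        (Eventually.of_forall fun p => ?_)).trans (by simp)
      rw [LinearIsometry.norm_map]
      exact (T.le_opNorm _).trans (by rw [LinearIsometry.norm_map]))

/-- The dephasing function `g(ξ) = ∫ e^{i p ξ / ħ} dκ(p)`. -/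
def dephasingFunction (ħ : ℝ) (κ : Measure ℝ) (ξ : ℝ) : ℂ := ∫ p, phase ħ p ξ ∂κ

/-- The relative-entropy `g`-dephasing loss `S(ρ ‖ Δ_g(ρ))`, with values in `[-∞, +∞]`. -/
def relEntropyLoss (ħ : ℝ) (κ : Measure ℝ) [IsProbabilityMeasure κ] (ρ : L2R →L[ℂ] L2R) : EReal :=
  relativeEntropy ρ (dephasing ħ κ ρ)

end QuantumCoherence

end

noncomputable section

namespace QuantumCoherence

section Hilbert

set_option linter.unusedSectionVars false
variable {H : Type*} [NormedAddCommGroup H] [InnerProductSpace ℂ H] [CompleteSpace H]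

/-! ### Operators of finite trace are compact -/

/-! Nonnegativity is Klein's inequality. For normal states the weights w(a,b) = Tr(P_a Q_b) are
nonnegative with ∑ w a = Tr ρ = 1 and ∑ w b = Tr σ = 1, so the entropy equals ∑ w (a(ln a - ln b) -
a + b). Each bracket is ≥ 0, strictly so when a ≠ b. Since the entropy is a difference of two
`ℝ≥0∞`-sums, the bracket is split: a joins the negative part, b the positive part, and each sum
grows by 1. Zero entropy therefore kills every off-diagonal weight, and σ = ρ. The spectral
resolutions exist because finite trace forces compactness.

The channel averages unitary conjugations, so it preserves normal states, and zero loss means Δ(ρ) =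
ρ. The top eigenspace E of ρ is nonzero and finite-dimensional. For ψ in E, ⟨ψ, ρψ⟩ = ‖ρ‖‖ψ‖² is the
κ-average of quantities bounded by the same value, so κ-almost every kick keeps ψ in E. If κ charged
p ≠ 0, some nontrivial kick would preserve E and have an eigenvector there; but the level sets of
its phase are Lebesgue-null. Hence κ is concentrated at 0 and g ≡ 1, against |g| < 1. -/

theorem inner_self_eq_ofReal_sq_norm (x : H) : ⟪x, x⟫_ℂ = ((‖x‖ ^ 2 : ℝ) : ℂ) := by
  rw [inner_self_eq_norm_sq_to_K]
  simp

/-- The operator norm is at most the Hilbert–Schmidt norm. -/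
theorem opNorm_le_sqrt_of_hasSum {ι : Type*} (b : HilbertBasis ι ℂ H) (R : H →L[ℂ] H) {c : ℝ}
    (hc : HasSum (fun i => ‖R (b i)‖ ^ 2) c) : ‖R‖ ≤ √c := by
  -- Passing to the adjoint: ‖R†y‖² = ∑ |⟨R bᵢ, y⟩|², and Cauchy–Schwarz bounds each term.
  rw [← ContinuousLinearMap.adjoint.norm_map R]
  refine ContinuousLinearMap.opNorm_le_bound _ (Real.sqrt_nonneg _) fun y => ?_
  have hc0 : 0 ≤ c := hc.nonneg fun i => by positivity
  rw [← Real.sqrt_sq (norm_nonneg y), ← Real.sqrt_mul hc0]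
  refine Real.le_sqrt_of_sq_le ?_
  rw [← ENNReal.ofReal_le_ofReal_iff (by positivity), ← tsum_inner_sq b, ← hc.tsum_eq,
    ← tsum_mul_right, ENNReal.ofReal_tsum_of_nonneg (fun i => by positivity)
      (hc.summable.mul_right _)]
  refine ENNReal.tsum_le_tsum fun i => ENNReal.ofReal_le_ofReal ?_
  rw [ContinuousLinearMap.adjoint_inner_right, ← mul_pow]
  gcongr
  exact norm_inner_le_norm _ _

/-- A Hilbert–Schmidt operator is the norm limit of its finite-rank truncations, the error being at
most the Hilbert–Schmidt norm of the tail. -/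
theorem isCompactOperator_of_summable_sq_norm {ι : Type*} (b : HilbertBasis ι ℂ H)
    (S : H →L[ℂ] H) (hS : Summable fun i => ‖S (b i)‖ ^ 2) : IsCompactOperator S := by
  classical
  let F : Finset ι → H →L[ℂ] H := fun s =>
    ∑ i ∈ s, (innerSL ℂ (b i)).smulRight (S (b i))
  have hFb : ∀ s j, F s (b j) = if j ∈ s then S (b j) else 0 := by
    intro s j
    simp only [F, sum_apply, ContinuousLinearMap.smulRight_apply,
      innerSL_apply_apply, orthonormal_iff_ite.1 b.orthonormal, ite_smul, one_smul, zero_smul]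
    simp
  have hsum : ∀ s : Finset ι, HasSum (fun i => ‖(S - F s) (b i)‖ ^ 2)
      (∑' i : { i // i ∉ s }, ‖S (b i)‖ ^ 2) := by
    intro s
    have h1 : (fun i => ‖(S - F s) (b i)‖ ^ 2) =
        Set.indicator {i | i ∉ s} (fun i => ‖S (b i)‖ ^ 2) := by
      funext i
      by_cases hi : i ∈ s <;> simp [hFb, hi]
    rw [h1]
    exact (hasSum_subtype_iff_indicator (s := {i | i ∉ s})).1 (hS.subtype _).hasSum
  have hlim : Tendsto F atTop (𝓝 S) := by
    rw [tendsto_iff_norm_sub_tendsto_zero]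
    have h0 : Tendsto (fun s : Finset ι => √(∑' i : { i // i ∉ s }, ‖S (b i)‖ ^ 2)) atTop
        (𝓝 0) := by
      simpa using (tendsto_tsum_compl_atTop_zero fun i => ‖S (b i)‖ ^ 2).sqrt
    refine squeeze_zero (fun s => norm_nonneg _) (fun s => ?_) h0
    rw [norm_sub_rev]
    exact opNorm_le_sqrt_of_hasSum b _ (hsum s)
  refine isCompactOperator_of_tendsto hlim (Eventually.of_forall fun s => ?_)
  have hrank : ∀ i, IsCompactOperator ((innerSL ℂ (b i)).smulRight (S (b i))) := fun i =>
    (isCompactOperator_of_locallyCompactSpace_dom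
      (innerSL ℂ (b i))).clm_comp
      ((ContinuousLinearMap.id ℂ ℂ).smulRight (S (b i)))
  exact Submodule.sum_mem (compactOperator (RingHom.id ℂ) H H) fun i _ => hrank i

/-- ∑ ‖√T bᵢ‖² = Tr T, so √T is Hilbert–Schmidt, hence compact, and so is T = √T √T. -/
theorem isCompactOperator_of_posTrace_ne_top {T : H →L[ℂ] H} (hT : T.IsPositive)
    (htr : posTrace T ≠ ⊤) : IsCompactOperator T := by
  have hT0 : 0 ≤ T := T.nonneg_iff_isPositive.2 hT
  have hsq : CFC.sqrt T * CFC.sqrt T = T := CFC.sqrt_mul_sqrt_self T hT0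
  have hsa : IsSelfAdjoint (CFC.sqrt T) := (CFC.sqrt_nonneg T).isSelfAdjoint
  have key : ∀ x : H, (⟪x, T x⟫_ℂ).re = ‖CFC.sqrt T x‖ ^ 2 := by
    intro x
    have h1 : ⟪CFC.sqrt T x, CFC.sqrt T x⟫_ℂ = ⟪x, CFC.sqrt T (CFC.sqrt T x)⟫_ℂ :=
      hsa.isSymmetric x _
    have h2 : CFC.sqrt T (CFC.sqrt T x) = T x := congrArg (fun S : H →L[ℂ] H => S x) hsq
    rw [← h2, ← h1, inner_self_eq_ofReal_sq_norm, Complex.ofReal_re]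
  have hs : Summable fun i => ‖CFC.sqrt T (someBasis H i)‖ ^ 2 := by
    rw [posTrace] at htr
    simp only [key] at htr
    have h := ENNReal.summable_toReal htr
    simpa [ENNReal.toReal_ofReal] using h
  have hc := isCompactOperator_of_summable_sq_norm (someBasis H) (CFC.sqrt T) hs
  have h2 := hc.comp_clm (CFC.sqrt T)
  rw [← hsq]
  exact h2

/-! ### Spectral decomposition -/

theorem mem_ker_sub_smul_id {T : H →L[ℂ] H} {a : ℝ} {x : H} :
    x ∈ (T - (a : ℂ) • ContinuousLinearMap.id ℂ H).ker ↔ T x = (a : ℂ) • x := by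
  simp [sub_eq_zero]

theorem eigenspace_eq_ker (T : H →L[ℂ] H) (a : ℝ) :
    Module.End.eigenspace (T : Module.End ℂ H) (a : ℂ) =
      (T - (a : ℂ) • ContinuousLinearMap.id ℂ H).ker := by
  ext x
  rw [mem_ker_sub_smul_id, Module.End.mem_eigenspace_iff]
  rfl

theorem apply_eigenProj (T : H →L[ℂ] H) (a : ℝ) (x : H) :
    T (eigenProj T a x) = (a : ℂ) • eigenProj T a x :=
  mem_ker_sub_smul_id.1 (Submodule.starProjection_apply_mem _ x)

theorem eigenProj_eq_self_iff {T : H →L[ℂ] H} {a : ℝ} {x : H} :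
    eigenProj T a x = x ↔ T x = (a : ℂ) • x :=
  Submodule.starProjection_eq_self_iff.trans mem_ker_sub_smul_id

theorem eigenProj_eigenProj (T : H →L[ℂ] H) (a : ℝ) (x : H) :
    eigenProj T a (eigenProj T a x) = eigenProj T a x :=
  eigenProj_eq_self_iff.2 (apply_eigenProj T a x)

theorem inner_eigenProj_left (T : H →L[ℂ] H) (a : ℝ) (x y : H) :
    ⟪eigenProj T a x, y⟫_ℂ = ⟪x, eigenProj T a y⟫_ℂ :=
  Submodule.inner_starProjection_left_eq_right _ x y

theorem inner_eigenProj_self (T : H →L[ℂ] H) (a : ℝ) (x : H) :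
    ⟪x, eigenProj T a x⟫_ℂ = ((‖eigenProj T a x‖ ^ 2 : ℝ) : ℂ) := by
  rw [← eigenProj_eigenProj, ← inner_eigenProj_left, eigenProj_eigenProj,
    inner_self_eq_ofReal_sq_norm]

/-- Spectral sums range over all reals; this discards the negative indices, where the entropy
inequalities are not available. -/
theorem eigenProj_eq_zero_of_neg {T : H →L[ℂ] H} (hT : T.IsPositive) {a : ℝ} (ha : a < 0) :
    eigenProj T a = 0 := by
  ext x
  have h := hT.re_inner_nonneg_right (eigenProj T a x)
  rw [apply_eigenProj, inner_smul_right, inner_self_eq_ofReal_sq_norm] at h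
  have h : 0 ≤ a * ‖eigenProj T a x‖ ^ 2 := by
    rw [← Complex.ofReal_mul] at h
    exact h
  rw [zero_apply, ← norm_eq_zero]
  by_contra h0
  have : 0 < ‖eigenProj T a x‖ ^ 2 := by positivity
  nlinarith

/-- The spectral decomposition of the identity for a compact self-adjoint operator. -/
theorem hasSum_eigenProj {T : H →L[ℂ] H} (hT : IsCompactOperator T) (hT' : T.IsSymmetric)
    (x : H) : HasSum (fun a => eigenProj T a x) x := by
  let V : ℝ → Submodule ℂ H := fun a => (T - (a : ℂ) • ContinuousLinearMap.id ℂ H).ker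
  have hV : ∀ a, V a = Module.End.eigenspace (T : Module.End ℂ H) (a : ℂ) := fun a =>
    (eigenspace_eq_ker T a).symm
  have hortho : OrthogonalFamily ℂ (fun a => V a) fun a => (V a).subtypeₗᵢ := by
    have h := hT'.orthogonalFamily_eigenspaces
    have h2 := h.comp (γ := ℝ) (f := fun a : ℝ => (a : ℂ)) Complex.ofReal_injective
    intro a b hab v w
    exact h2 hab ⟨v, hV a ▸ v.2⟩ ⟨w, hV b ▸ w.2⟩
  -- Eigenvalues of a symmetric operator are real, so the real-indexed family loses nothing.
  have hsup : (⨆ μ : ℂ, Module.End.eigenspace (T : Module.End ℂ H) μ) ≤ ⨆ a, V a := by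
    refine iSup_le fun μ => ?_
    by_cases hμ : Module.End.HasEigenvalue (T : Module.End ℂ H) μ
    · have := hT'.conj_eigenvalue_eq_self hμ
      obtain ⟨r, rfl⟩ := Complex.conj_eq_iff_real.1 this
      rw [← hV]
      exact le_iSup V r
    · rw [Module.End.hasEigenvalue_iff, not_not] at hμ
      rw [hμ]
      exact bot_le
  have htotal : ⊤ ≤ (⨆ a, V a).topologicalClosure := by
    rw [top_le_iff, Submodule.topologicalClosure_eq_top_iff, eq_bot_iff,
      ← ContinuousLinearMap.orthogonalComplement_iSup_eigenspaces_eq_bot hT hT']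
    exact Submodule.orthogonal_le hsup
  have hH := IsHilbertSum.mkInternal (F := V) hortho htotal
  have h1 := hH.hasSum_linearIsometryEquiv_symm (hH.linearIsometryEquiv x)
  rw [LinearIsometryEquiv.symm_apply_apply] at h1
  convert h1 using 2 with a
  -- Applying P_a to the whole sum leaves only its a-th component, by orthogonality.
  have h2 := h1.mapL (eigenProj T a)
  have h3 : HasSum (fun i => eigenProj T a ((V i).subtypeₗᵢ (hH.linearIsometryEquiv x i)))
      ((V a).subtypeₗᵢ (hH.linearIsometryEquiv x a)) := by
    have h4 : eigenProj T a ((V a).subtypeₗᵢ (hH.linearIsometryEquiv x a)) =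
        (V a).subtypeₗᵢ (hH.linearIsometryEquiv x a) :=
      Submodule.starProjection_eq_self_iff.2 (hH.linearIsometryEquiv x a).2
    have h5 := hasSum_single (f := fun i =>
      eigenProj T a ((V i).subtypeₗᵢ (hH.linearIsometryEquiv x i))) a fun i hi => by
        refine (Submodule.starProjection_apply_eq_zero_iff _).2 ?_
        rw [Submodule.mem_orthogonal]
        intro u hu
        exact hortho hi.symm ⟨u, hu⟩ _
    rwa [h4] at h5
  exact h2.unique h3

theorem tsum_sq_norm_eigenProj {T : H →L[ℂ] H} (hT : IsCompactOperator T) (hT' : T.IsSymmetric)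
    (x : H) : ∑' a : ℝ, ENNReal.ofReal (‖eigenProj T a x‖ ^ 2) = ENNReal.ofReal (‖x‖ ^ 2) := by
  have h1 := Complex.hasSum_re ((hasSum_eigenProj hT hT' x).mapL (innerSL ℂ x))
  simp only [innerSL_apply_apply, inner_eigenProj_self, Complex.ofReal_re,
    inner_self_eq_ofReal_sq_norm] at h1
  rw [← ENNReal.ofReal_tsum_of_nonneg (fun i => by positivity) h1.summable, h1.tsum_eq]

theorem tsum_mul_sq_norm_eigenProj {T : H →L[ℂ] H} (hT : IsCompactOperator T)
    (hT' : T.IsPositive) (x : H) :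
    ∑' a : ℝ, ENNReal.ofReal a * ENNReal.ofReal (‖eigenProj T a x‖ ^ 2) =
      ENNReal.ofReal (⟪x, T x⟫_ℂ).re := by
  have hs := hT'.isSymmetric
  have h1 := Complex.hasSum_re (((hasSum_eigenProj hT hs x).mapL T).mapL (innerSL ℂ x))
  simp only [innerSL_apply_apply, apply_eigenProj, inner_smul_right, inner_eigenProj_self] at h1
  norm_cast at h1
  have h0 : ∀ a : ℝ, 0 ≤ a * ‖eigenProj T a x‖ ^ 2 := by
    intro a
    rcases lt_or_ge a 0 with ha | ha
    · simp [eigenProj_eq_zero_of_neg hT' ha]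
    · positivity
  rw [← h1.tsum_eq, ENNReal.ofReal_tsum_of_nonneg h0 h1.summable]
  congr 1
  funext a
  rw [ENNReal.ofReal_mul' (by positivity)]

/-! ### Klein's inequality -/

theorem IsNormalState.isCompactOperator {ρ : H →L[ℂ] H} (hρ : IsNormalState ρ) :
    IsCompactOperator ρ :=
  isCompactOperator_of_posTrace_ne_top hρ.1 (by rw [hρ.2]; exact ENNReal.one_ne_top)

theorem spectralOverlap_eq_tsum (ρ σ : H →L[ℂ] H) (a b : ℝ) :
    spectralOverlap ρ σ a b =
      ∑' i, ENNReal.ofReal (‖eigenProj σ b (eigenProj ρ a (someBasis H i))‖ ^ 2) := by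
  simp only [spectralOverlap, posTrace, ContinuousLinearMap.comp_apply]
  simp only [← inner_eigenProj_left ρ, inner_eigenProj_self, Complex.ofReal_re]

/-- Both sides are squared Hilbert–Schmidt norms, of Q_b P_a and of its adjoint P_a Q_b. -/
theorem spectralOverlap_comm (ρ σ : H →L[ℂ] H) (a b : ℝ) :
    spectralOverlap ρ σ a b = spectralOverlap σ ρ b a := by
  rw [spectralOverlap_eq_tsum, spectralOverlap_eq_tsum]
  simp only [← tsum_inner_sq (someBasis H)]
  rw [ENNReal.tsum_comm]
  congr! 5 with i j
  rw [← inner_eigenProj_left, ← inner_eigenProj_left, norm_inner_symm]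

/-- Summing over b first removes σ, since ∑_b ‖Q_b P_a eᵢ‖² = ‖P_a eᵢ‖²; what remains is Tr ρ. -/
theorem tsum_spectralOverlap_mul {ρ σ : H →L[ℂ] H} (hρ : IsNormalState ρ)
    (hσ : IsNormalState σ) :
    ∑' (a : ℝ) (b : ℝ), spectralOverlap ρ σ a b * ENNReal.ofReal a = 1 := by
  simp only [ENNReal.tsum_mul_right, spectralOverlap_eq_tsum]
  rw [← hρ.2, posTrace]
  simp only [← tsum_mul_sq_norm_eigenProj hρ.isCompactOperator hρ.1]
  rw [ENNReal.tsum_comm (f := fun i a => _)]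
  congr 1
  funext a
  rw [ENNReal.tsum_comm, ENNReal.tsum_mul_left, mul_comm]
  simp only [tsum_sq_norm_eigenProj hσ.isCompactOperator hσ.1.isSymmetric]

theorem tsum_spectralOverlap_mul' {ρ σ : H →L[ℂ] H} (hρ : IsNormalState ρ)
    (hσ : IsNormalState σ) :
    ∑' (a : ℝ) (b : ℝ), spectralOverlap ρ σ a b * ENNReal.ofReal b = 1 := by
  rw [ENNReal.tsum_comm]
  simp only [spectralOverlap_comm ρ σ]
  exact tsum_spectralOverlap_mul hσ hρ

theorem spectralOverlap_eq_zero_of_neg_left {ρ : H →L[ℂ] H} (hρ : ρ.IsPositive)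
    (σ : H →L[ℂ] H) {a : ℝ} (ha : a < 0) (b : ℝ) : spectralOverlap ρ σ a b = 0 := by
  rw [spectralOverlap_eq_tsum, eigenProj_eq_zero_of_neg hρ ha]
  simp

theorem spectralOverlap_eq_zero_of_neg_right (ρ : H →L[ℂ] H) {σ : H →L[ℂ] H}
    (hσ : σ.IsPositive) (a : ℝ) {b : ℝ} (hb : b < 0) : spectralOverlap ρ σ a b = 0 := by
  rw [spectralOverlap_comm, spectralOverlap_eq_zero_of_neg_left hσ _ hb]

theorem sub_lt_mul_log_sub_log {a b : ℝ} (ha : 0 < a) (hb : 0 < b) (hab : a ≠ b) :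
    a - b < a * (Real.log a - Real.log b) := by
  have h1 : Real.log (b / a) < b / a - 1 :=
    Real.log_lt_sub_one_of_pos (by positivity) (by rw [Ne, div_eq_one_iff_eq ha.ne']; tauto)
  rw [Real.log_div hb.ne' ha.ne'] at h1
  have h2 := mul_lt_mul_of_pos_left h1 ha
  have h3 : a * (b / a - 1) = b - a := by field_simp
  linarith

/-- The scalar bound a - b < a(ln a - ln b), from ln t < t - 1 at t = b/a, rearranged so that no
subtraction occurs in `ℝ≥0∞`. -/
theorem entropyTerm_lt {a b : ℝ} (ha : 0 ≤ a) (hb : 0 ≤ b) (hab : a ≠ b) :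
    (-entropyTerm a b).toENNReal + ENNReal.ofReal a <
      (entropyTerm a b).toENNReal + ENNReal.ofReal b := by
  unfold entropyTerm
  split_ifs with h1 h2
  · subst h1
    simpa using lt_of_le_of_ne hb hab
  · simp
  · have ha' : 0 < a := lt_of_le_of_ne ha (Ne.symm h1)
    have hb' : 0 < b := lt_of_le_of_ne hb (Ne.symm h2)
    have h := sub_lt_mul_log_sub_log ha' hb' hab
    set t := a * (Real.log a - Real.log b)
    rw [← EReal.coe_neg, EReal.toENNReal_of_ne_top (EReal.coe_ne_top _),
      EReal.toENNReal_of_ne_top (EReal.coe_ne_top _), EReal.toReal_coe, EReal.toReal_coe]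
    rcases le_total 0 t with ht | ht
    · rw [ENNReal.ofReal_of_nonpos (by linarith), zero_add, ← ENNReal.ofReal_add ht hb]
      exact (ENNReal.ofReal_lt_ofReal_iff (by positivity)).2 (by linarith)
    · rw [ENNReal.ofReal_of_nonpos ht, zero_add, ← ENNReal.ofReal_add (by linarith) ha]
      exact (ENNReal.ofReal_lt_ofReal_iff hb').2 (by linarith)

theorem entropyTerm_self (a : ℝ) : entropyTerm a a = 0 := by
  unfold entropyTerm
  split_ifs <;> simp

theorem entropyTerm_le {a b : ℝ} (ha : 0 ≤ a) (hb : 0 ≤ b) :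
    (-entropyTerm a b).toENNReal + ENNReal.ofReal a ≤
      (entropyTerm a b).toENNReal + ENNReal.ofReal b := by
  rcases eq_or_ne a b with rfl | hab
  · simp [entropyTerm_self]
  · exact (entropyTerm_lt ha hb hab).le

theorem toENNReal_neg_entropyTerm_le {a b : ℝ} (ha : 0 ≤ a) (hb : 0 ≤ b) :
    (-entropyTerm a b).toENNReal ≤ ENNReal.ofReal b := by
  rcases le_total 0 (entropyTerm a b) with h | h
  · rw [EReal.toENNReal_of_nonpos (EReal.neg_le_zero.2 h)]
    exact zero_le
  · have h1 := entropyTerm_le ha hb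
    rw [EReal.toENNReal_of_nonpos h, zero_add] at h1
    exact le_self_add.trans h1

variable {ρ σ : H →L[ℂ] H}

theorem spectralOverlap_mul_le (hρ : ρ.IsPositive) (hσ : σ.IsPositive) (a b : ℝ)
    {f g : ℝ → ℝ → ℝ≥0∞} (hfg : 0 ≤ a → 0 ≤ b → f a b ≤ g a b) :
    spectralOverlap ρ σ a b * f a b ≤ spectralOverlap ρ σ a b * g a b := by
  rcases lt_or_ge a 0 with ha | ha
  · simp [spectralOverlap_eq_zero_of_neg_left hρ σ ha]
  rcases lt_or_ge b 0 with hb | hb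
  · simp [spectralOverlap_eq_zero_of_neg_right ρ hσ a hb]
  exact mul_le_mul_right (hfg ha hb) _

theorem tsum_neg_entropyTerm_le_one (hρ : IsNormalState ρ) (hσ : IsNormalState σ) :
    ∑' (a : ℝ) (b : ℝ), spectralOverlap ρ σ a b * (-entropyTerm a b).toENNReal ≤ 1 := by
  rw [← tsum_spectralOverlap_mul' hρ hσ]
  exact ENNReal.tsum_le_tsum fun a => ENNReal.tsum_le_tsum fun b =>
    spectralOverlap_mul_le hρ.1 hσ.1 a b (f := fun a b => (-entropyTerm a b).toENNReal)
      (g := fun _ b => ENNReal.ofReal b) toENNReal_neg_entropyTerm_le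

theorem tsum_neg_entropyTerm_add_one (hρ : IsNormalState ρ) (hσ : IsNormalState σ) :
    ∑' (a : ℝ) (b : ℝ), spectralOverlap ρ σ a b * (-entropyTerm a b).toENNReal + 1 =
      ∑' (a : ℝ) (b : ℝ), spectralOverlap ρ σ a b *
        ((-entropyTerm a b).toENNReal + ENNReal.ofReal a) := by
  simp only [mul_add, ENNReal.tsum_add]
  rw [tsum_spectralOverlap_mul hρ hσ]

theorem tsum_entropyTerm_add_one (hρ : IsNormalState ρ) (hσ : IsNormalState σ) :
    ∑' (a : ℝ) (b : ℝ), spectralOverlap ρ σ a b * (entropyTerm a b).toENNReal + 1 =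
      ∑' (a : ℝ) (b : ℝ), spectralOverlap ρ σ a b *
        ((entropyTerm a b).toENNReal + ENNReal.ofReal b) := by
  simp only [mul_add, ENNReal.tsum_add]
  rw [tsum_spectralOverlap_mul' hρ hσ]

/-- **Klein's inequality**: the relative entropy of normal states is nonnegative. -/
theorem relativeEntropy_nonneg (hρ : IsNormalState ρ) (hσ : IsNormalState σ) :
    0 ≤ relativeEntropy ρ σ := by
  have h1 : ∑' (a : ℝ) (b : ℝ), spectralOverlap ρ σ a b * (-entropyTerm a b).toENNReal + 1 ≤
      ∑' (a : ℝ) (b : ℝ), spectralOverlap ρ σ a b * (entropyTerm a b).toENNReal + 1 := by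
    rw [tsum_neg_entropyTerm_add_one hρ hσ, tsum_entropyTerm_add_one hρ hσ]
    exact ENNReal.tsum_le_tsum fun a => ENNReal.tsum_le_tsum fun b =>
      spectralOverlap_mul_le hρ.1 hσ.1 a b
        (f := fun a b => (-entropyTerm a b).toENNReal + ENNReal.ofReal a)
        (g := fun a b => (entropyTerm a b).toENNReal + ENNReal.ofReal b) entropyTerm_le
  have h2 := (ENNReal.add_le_add_iff_right ENNReal.one_ne_top).1 h1
  have h3 := (tsum_neg_entropyTerm_le_one hρ hσ).trans_lt ENNReal.one_lt_top
  rw [relativeEntropy]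
  refine (EReal.sub_nonneg (Or.inr ?_) (Or.inr ?_)).2 (EReal.coe_ennreal_le_coe_ennreal_iff.2 h2)
  · simpa using h3.ne
  · exact EReal.coe_ennreal_ne_bot _

theorem eq_of_coe_sub_coe_eq_zero {A B : ℝ≥0∞} (hB : B ≠ ⊤) (h : (A : EReal) - (B : EReal) = 0) :
    A = B := by
  lift B to NNReal using hB
  induction A with
  | top =>
    exfalso
    simp at h
  | coe A =>
    have h' : (((A : ℝ) - (B : ℝ) : ℝ) : EReal) = ((0 : ℝ) : EReal) := h
    have := EReal.coe_injective h'
    have h2 : (A : ℝ) = B := by linarith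
    exact_mod_cast h2

/-- One off-diagonal pair of nonzero weight would make the termwise comparison in Klein's inequality
strict, hence also the finite sums. -/
theorem spectralOverlap_eq_zero_of_relativeEntropy_eq_zero (hρ : IsNormalState ρ)
    (hσ : IsNormalState σ) (h0 : relativeEntropy ρ σ = 0) {a b : ℝ} (hab : a ≠ b) :
    spectralOverlap ρ σ a b = 0 := by
  by_contra hw
  have ha : 0 ≤ a := by
    by_contra! ha
    exact hw (spectralOverlap_eq_zero_of_neg_left hρ.1 σ ha b)
  have hb : 0 ≤ b := by
    by_contra! hb
    exact hw (spectralOverlap_eq_zero_of_neg_right ρ hσ.1 a hb)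
  have hfin := (tsum_neg_entropyTerm_le_one hρ hσ).trans_lt ENNReal.one_lt_top
  have heq := eq_of_coe_sub_coe_eq_zero hfin.ne h0
  have heq1 : ∑' (a : ℝ) (b : ℝ), spectralOverlap ρ σ a b *
        ((-entropyTerm a b).toENNReal + ENNReal.ofReal a) =
      ∑' (a : ℝ) (b : ℝ), spectralOverlap ρ σ a b *
        ((entropyTerm a b).toENNReal + ENNReal.ofReal b) := by
    rw [← tsum_neg_entropyTerm_add_one hρ hσ, ← tsum_entropyTerm_add_one hρ hσ, heq]
  have hfin1 : ∑' (a : ℝ) (b : ℝ), spectralOverlap ρ σ a b *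
        ((-entropyTerm a b).toENNReal + ENNReal.ofReal a) ≠ ⊤ := by
    rw [← tsum_neg_entropyTerm_add_one hρ hσ]
    exact ENNReal.add_ne_top.2 ⟨hfin.ne, ENNReal.one_ne_top⟩
  have hlt := entropyTerm_lt ha hb hab
  -- Strictness survives multiplication only by a finite weight; an infinite one would make the
  -- finite sum infinite, as its factor is positive.
  have hwtop : spectralOverlap ρ σ a b ≠ ⊤ := by
    intro htop
    rw [heq1] at hfin1
    have h1 := ENNReal.ne_top_of_tsum_ne_top (ENNReal.ne_top_of_tsum_ne_top hfin1 a) b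
    rw [htop] at h1
    exact h1 (ENNReal.top_mul (bot_lt_of_lt hlt).ne')
  simp only [← ENNReal.tsum_prod] at heq1 hfin1
  refine (ENNReal.tsum_lt_tsum (i := (a, b)) hfin1 (fun p => ?_) ?_).ne heq1
  · exact spectralOverlap_mul_le hρ.1 hσ.1 p.1 p.2
        (f := fun a b => (-entropyTerm a b).toENNReal + ENNReal.ofReal a)
        (g := fun a b => (entropyTerm a b).toENNReal + ENNReal.ofReal b) entropyTerm_le
  · exact ENNReal.mul_lt_mul_right hw hwtop hlt

/-- Equality in Klein's inequality. -/
theorem eq_of_relativeEntropy_eq_zero (hρ : IsNormalState ρ) (hσ : IsNormalState σ)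
    (h0 : relativeEntropy ρ σ = 0) : σ = ρ := by
  have hzero : ∀ a b : ℝ, a ≠ b → ∀ x, eigenProj σ b (eigenProj ρ a x) = 0 := by
    intro a b hab x
    have h1 := spectralOverlap_eq_zero_of_relativeEntropy_eq_zero hρ hσ h0 hab
    rw [spectralOverlap_eq_tsum, ENNReal.tsum_eq_zero] at h1
    have h2 := ((someBasis H).hasSum_repr x).mapL (eigenProj σ b ∘L eigenProj ρ a)
    have h3 : ∀ i, (eigenProj σ b ∘L eigenProj ρ a) (someBasis H i) = 0 := by
      intro i
      have := h1 i
      rw [ENNReal.ofReal_eq_zero] at this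
      rw [← norm_eq_zero]
      exact pow_eq_zero_iff two_ne_zero |>.1 (le_antisymm this (by positivity))
    simp only [map_smul, h3, smul_zero] at h2
    exact h2.unique hasSum_zero
  -- In the σ-resolution of P_a x only the term Q_a survives, so σ acts on P_a x as a, just as ρ
  -- does.
  have hfix : ∀ (a : ℝ) (x : H), eigenProj σ a (eigenProj ρ a x) = eigenProj ρ a x := by
    intro a x
    have h1 := hasSum_eigenProj hσ.isCompactOperator hσ.1.isSymmetric (eigenProj ρ a x)
    exact (hasSum_single a fun b hb => hzero a b hb.symm x).unique h1
  ext x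
  have h1 := (hasSum_eigenProj hρ.isCompactOperator hρ.1.isSymmetric x).mapL σ
  have h2 := (hasSum_eigenProj hρ.isCompactOperator hρ.1.isSymmetric x).mapL ρ
  refine h1.unique ?_
  convert h2 using 2 with a
  rw [apply_eigenProj, eigenProj_eq_self_iff.1 (hfix a x)]

end Hilbert

/-! ### Dephasing preserves normal states -/

/-- Orthonormal vectors are uniformly separated. Countability of the basis permits exchanging trace
and κ-integral. -/
theorem countable_of_orthonormal {H : Type*} [NormedAddCommGroup H] [InnerProductSpace ℂ H]
    [SecondCountableTopology H] {ι : Type*} {v : ι → H} (hv : Orthonormal ℂ v) : Countable ι := by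
  have hd : ∀ i j, i ≠ j → 1 ≤ dist (v i) (v j) := by
    intro i j hij
    have h1 := norm_sub_sq (𝕜 := ℂ) (v i) (v j)
    rw [hv.2 hij, hv.1, hv.1] at h1
    rw [dist_eq_norm]
    simp at h1
    nlinarith [norm_nonneg (v i - v j)]
  have hinj : Function.Injective v := hv.linearIndependent.injective
  have : DiscreteTopology (Set.range v) := by
    refine DiscreteTopology.of_forall_le_dist zero_lt_one ?_
    rintro ⟨_, i, rfl⟩ ⟨_, j, rfl⟩ hij
    exact hd i j fun h => hij (by simp [h])
  have : Countable (Set.range v) := TopologicalSpace.separableSpace_iff_countable.1 inferInstance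
  exact (Set.rangeFactorization_injective.2 hinj).countable

theorem momentumKick_momentumKick_neg (ħ p : ℝ) (ψ : L2R) :
    momentumKick ħ p (momentumKick ħ (-p) ψ) = ψ := by
  apply Lp.ext
  filter_upwards [momentumKick_coeFn ħ p (momentumKick ħ (-p) ψ),
    momentumKick_coeFn ħ (-p) ψ] with x h1 h2
  rw [h1, h2, ← mul_assoc, phase, phase, ← Complex.exp_add, ← add_mul, ← Complex.ofReal_add]
  simp [neg_div]

theorem inner_momentumKick (ħ p : ℝ) (φ ψ : L2R) :
    ⟪φ, momentumKick ħ p ψ⟫_ℂ = ⟪momentumKick ħ (-p) φ, ψ⟫_ℂ := by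
  rw [← (momentumKick ħ p).inner_map_map (momentumKick ħ (-p) φ), momentumKick_momentumKick_neg]

/-- The unitary `e^{i p X / ħ}` as an isometric equivalence. -/
def momentumKickEquiv (ħ p : ℝ) : L2R ≃ₗᵢ[ℂ] L2R :=
  LinearIsometryEquiv.ofSurjective (momentumKick ħ p) fun ψ =>
    ⟨_, momentumKick_momentumKick_neg ħ p ψ⟩

/-- The image of a Hilbert basis under a momentum kick. -/
def kickedBasis {ι : Type*} (b : HilbertBasis ι ℂ L2R) (ħ p : ℝ) : HilbertBasis ι ℂ L2R :=
  HilbertBasis.ofRepr ((momentumKickEquiv ħ p).symm.trans b.repr)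

theorem kickedBasis_apply {ι : Type*} (b : HilbertBasis ι ℂ L2R) (ħ p : ℝ) (i : ι) :
    kickedBasis b ħ p i = momentumKick ħ p (b i) := by
  classical
  rw [← (kickedBasis b ħ p).repr_symm_single, ← b.repr_symm_single]
  rfl

section

variable (ħ : ℝ) (κ : Measure ℝ) [IsProbabilityMeasure κ] (T : L2R →L[ℂ] L2R)

theorem continuous_inner_kicked (φ ψ : L2R) :
    Continuous fun p => ⟪momentumKick ħ (-p) φ, T (momentumKick ħ (-p) ψ)⟫_ℂ := by
  simp only [← inner_momentumKick]
  exact continuous_const.inner (continuous_kicked ħ T ψ)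

theorem integrable_inner_kicked (φ ψ : L2R) :
    Integrable (fun p => ⟪momentumKick ħ (-p) φ, T (momentumKick ħ (-p) ψ)⟫_ℂ) κ := by
  simp only [← inner_momentumKick]
  exact (integrable_kicked ħ κ T ψ).const_inner φ

theorem inner_dephasing (φ ψ : L2R) :
    ⟪φ, dephasing ħ κ T ψ⟫_ℂ =
      ∫ p, ⟪momentumKick ħ (-p) φ, T (momentumKick ħ (-p) ψ)⟫_ℂ ∂κ := by
  simp only [← inner_momentumKick]
  exact (integral_inner (integrable_kicked ħ κ T ψ) φ).symm

theorem re_inner_dephasing (ψ : L2R) :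
    (⟪ψ, dephasing ħ κ T ψ⟫_ℂ).re =
      ∫ p, (⟪momentumKick ħ (-p) ψ, T (momentumKick ħ (-p) ψ)⟫_ℂ).re ∂κ := by
  rw [inner_dephasing]
  exact (integral_re (integrable_inner_kicked ħ κ T ψ ψ)).symm

variable {T}

theorem isPositive_dephasing (hT : T.IsPositive) : (dephasing ħ κ T).IsPositive := by
  refine ⟨fun ψ φ => ?_, fun ψ => ?_⟩
  · change ⟪dephasing ħ κ T ψ, φ⟫_ℂ = ⟪ψ, dephasing ħ κ T φ⟫_ℂ
    rw [← inner_conj_symm, inner_dephasing, inner_dephasing, ← integral_conj]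
    congr 1
    funext p
    rw [inner_conj_symm]
    exact hT.isSymmetric _ _
  · rw [ContinuousLinearMap.reApplyInnerSelf_apply, inner_re_symm]
    change 0 ≤ (⟪ψ, dephasing ħ κ T ψ⟫_ℂ).re
    rw [re_inner_dephasing]
    exact integral_nonneg fun p => hT.re_inner_nonneg_right _

/-- By Tonelli the trace is an average over p of traces of T in kicked bases, all equal to Tr T. -/
theorem posTrace_dephasing (hT : T.IsPositive) : posTrace (dephasing ħ κ T) = posTrace T := by
  have : Fact ((2 : ℝ≥0∞) ≠ ⊤) := ⟨ENNReal.ofNat_ne_top⟩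
  have : Countable (basisIndex L2R) := countable_of_orthonormal (someBasis L2R).orthonormal
  have h1 : ∀ ψ : L2R, ENNReal.ofReal (⟪ψ, dephasing ħ κ T ψ⟫_ℂ).re =
      ∫⁻ p, ENNReal.ofReal (⟪momentumKick ħ (-p) ψ, T (momentumKick ħ (-p) ψ)⟫_ℂ).re ∂κ := by
    intro ψ
    rw [re_inner_dephasing]
    exact ofReal_integral_eq_lintegral_ofReal (integrable_inner_kicked ħ κ T ψ ψ).re
      (Eventually.of_forall fun p => hT.re_inner_nonneg_right _)
  have h2 : ∀ p, ∑' i, ENNReal.ofReal (⟪momentumKick ħ (-p) (someBasis L2R i),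
      T (momentumKick ħ (-p) (someBasis L2R i))⟫_ℂ).re = posTrace T := by
    intro p
    rw [posTrace_eq (kickedBasis (someBasis L2R) ħ (-p)) hT]
    simp only [kickedBasis_apply]
  rw [posTrace]
  simp only [h1]
  rw [← lintegral_tsum fun i => Measurable.aemeasurable ?_]
  · simp [h2]
  · exact (Complex.continuous_re.comp (continuous_inner_kicked ħ T _ _)).measurable.ennreal_ofReal

theorem IsNormalState.dephasing {ρ : L2R →L[ℂ] L2R} (hρ : IsNormalState ρ) :
    IsNormalState (dephasing ħ κ ρ) :=
  ⟨isPositive_dephasing ħ κ hρ.1, by rw [posTrace_dephasing ħ κ hρ.1, hρ.2]⟩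

end

/-! ### States fixed by dephasing -/

/-- Points of equal phase differ by integer multiples of 2πħ/p. -/
theorem countable_setOf_phase_eq {ħ p : ℝ} (hħ : ħ ≠ 0) (hp : p ≠ 0) (c : ℂ) :
    {x | phase ħ p x = c}.Countable := by
  rcases Set.eq_empty_or_nonempty {x | phase ħ p x = c} with h | ⟨y, hy⟩
  · rw [h]
    exact Set.countable_empty
  refine (Set.countable_range fun n : ℤ => y + n * (2 * Real.pi) * ħ / p).mono fun x hx => ?_
  have hxy : phase ħ p x = phase ħ p y := hx.trans hy.symm
  obtain ⟨n, hn⟩ := Complex.exp_eq_exp_iff_exists_int.1 hxy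
  refine ⟨n, ?_⟩
  have h1 : p * x / ħ = p * y / ħ + n * (2 * Real.pi) := by
    have h2 : (((p * x / ħ : ℝ) : ℂ)) * Complex.I =
        ((p * y / ħ + n * (2 * Real.pi) : ℝ) : ℂ) * Complex.I := by
      rw [hn]
      push_cast
      ring
    exact_mod_cast mul_right_cancel₀ Complex.I_ne_zero h2
  field_simp at h1 ⊢
  linarith

/-- A nontrivial momentum kick has no eigenvectors. -/
theorem eq_zero_of_momentumKick_eq_smul {ħ p : ℝ} (hħ : ħ ≠ 0) (hp : p ≠ 0) {c : ℂ} {ψ : L2R}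
    (h : momentumKick ħ p ψ = c • ψ) : ψ = 0 := by
  rw [Lp.eq_zero_iff_ae_eq_zero]
  have hnull : ∀ᵐ x : ℝ, phase ħ p x ≠ c :=
    (countable_setOf_phase_eq hħ hp c).ae_notMem volume
  have h1 := momentumKick_coeFn ħ p ψ
  rw [h] at h1
  filter_upwards [hnull, h1, Lp.coeFn_smul c ψ] with x hx h2 h3
  rw [h3, Pi.smul_apply, smul_eq_mul, mul_eq_mul_right_iff] at h2
  exact h2.resolve_left (Ne.symm hx)

theorem re_inner_le_norm_mul_sq {H : Type*} [NormedAddCommGroup H] [InnerProductSpace ℂ H]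
    (T : H →L[ℂ] H) (x : H) : (⟪x, T x⟫_ℂ).re ≤ ‖T‖ * ‖x‖ ^ 2 :=
  calc (⟪x, T x⟫_ℂ).re ≤ ‖x‖ * ‖T x‖ := re_inner_le_norm (𝕜 := ℂ) x (T x)
    _ ≤ ‖x‖ * (‖T‖ * ‖x‖) := by gcongr; exact T.le_opNorm x
    _ = ‖T‖ * ‖x‖ ^ 2 := by ring

theorem apply_eq_norm_smul_of_re_inner_eq {H : Type*} [NormedAddCommGroup H]
    [InnerProductSpace ℂ H] {T : H →L[ℂ] H} {x : H}
    (h : (⟪x, T x⟫_ℂ).re = ‖T‖ * ‖x‖ ^ 2) : T x = (‖T‖ : ℂ) • x := by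
  have h1 := norm_sub_sq (𝕜 := ℂ) (T x) ((‖T‖ : ℂ) • x)
  have h2 : RCLike.re ⟪T x, (‖T‖ : ℂ) • x⟫_ℂ = ‖T‖ * (‖T‖ * ‖x‖ ^ 2) := by
    rw [← h, inner_re_symm, inner_smul_left, Complex.conj_ofReal]
    exact Complex.re_ofReal_mul _ _
  rw [h2, norm_smul, Complex.norm_real, norm_norm] at h1
  have h3 : ‖T x‖ ^ 2 ≤ (‖T‖ * ‖x‖) ^ 2 := by gcongr; exact T.le_opNorm x
  -- Expanding the square gives ‖Tx‖² - 2‖T‖²‖x‖² + ‖T‖²‖x‖².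
  have h4 : ‖T x - (‖T‖ : ℂ) • x‖ ^ 2 ≤ 0 := by rw [h1]; linarith
  rw [← sub_eq_zero, ← norm_eq_zero]
  exact pow_eq_zero_iff two_ne_zero |>.1 (le_antisymm h4 (by positivity))

/-- The norm of a nonzero compact positive operator is an eigenvalue. -/
theorem hasEigenvalue_norm {H : Type*} [NormedAddCommGroup H] [InnerProductSpace ℂ H]
    [CompleteSpace H] {T : H →L[ℂ] H} (hc : IsCompactOperator T) (hT : T.IsPositive)
    (h0 : T ≠ 0) : Module.End.HasEigenvalue (T : Module.End ℂ H) (‖T‖ : ℂ) := by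
  have : Nontrivial (H →L[ℂ] H) := ⟨T, 0, h0⟩
  have h1 : ‖T‖ ∈ spectrum ℝ T :=
    CStarAlgebra.norm_mem_spectrum_of_nonneg (T.nonneg_iff_isPositive.2 hT)
  rw [hc.hasEigenvalue_iff_mem_spectrum (by simpa using h0)]
  exact (spectrum.algebraMap_mem_iff ℂ).2 h1

/-- The defect ‖T‖‖ψ‖² - ⟨U₋ₚψ, T U₋ₚψ⟩ is nonnegative with zero κ-mean, so it vanishes almost
everywhere; equality there forces an eigenvector. -/
theorem ae_momentumKick_mem_eigenspace {ħ : ℝ} {κ : Measure ℝ} [IsProbabilityMeasure κ]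
    {T : L2R →L[ℂ] L2R} (hfix : dephasing ħ κ T = T) {ψ : L2R}
    (hψ : ψ ∈ Module.End.eigenspace (T : Module.End ℂ L2R) (‖T‖ : ℂ)) :
    ∀ᵐ p ∂κ, momentumKick ħ (-p) ψ ∈
      Module.End.eigenspace (T : Module.End ℂ L2R) (‖T‖ : ℂ) := by
  have hTψ : T ψ = (‖T‖ : ℂ) • ψ := Module.End.mem_eigenspace_iff.1 hψ
  let f : ℝ → ℝ := fun p =>
    ‖T‖ * ‖ψ‖ ^ 2 - (⟪momentumKick ħ (-p) ψ, T (momentumKick ħ (-p) ψ)⟫_ℂ).re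
  have hint : Integrable
      (fun p => (⟪momentumKick ħ (-p) ψ, T (momentumKick ħ (-p) ψ)⟫_ℂ).re) κ :=
    (integrable_inner_kicked ħ κ T ψ ψ).re
  have hf0 : 0 ≤ f := fun p => by
    have := re_inner_le_norm_mul_sq T (momentumKick ħ (-p) ψ)
    rw [LinearIsometry.norm_map] at this
    exact sub_nonneg.2 this
  have hfint : ∫ p, f p ∂κ = 0 := by
    rw [integral_sub (integrable_const _) hint, integral_const, probReal_univ, one_smul]
    have h1 := re_inner_dephasing ħ κ T ψ
    rw [hfix, hTψ, inner_smul_right, inner_self_eq_ofReal_sq_norm, ← Complex.ofReal_mul,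
      Complex.ofReal_re] at h1
    rw [h1, sub_self]
  have h2 := (integral_eq_zero_iff_of_nonneg hf0 ((integrable_const _).sub hint)).1 hfint
  filter_upwards [h2] with p hp
  refine Module.End.mem_eigenspace_iff.2 (apply_eq_norm_smul_of_re_inner_eq ?_)
  rw [LinearIsometry.norm_map]
  exact (sub_eq_zero.1 hp).symm

/-- If dephasing fixes a normal state, then almost surely there is no momentum kick. -/
theorem ae_eq_zero_of_dephasing_eq_self {ħ : ℝ} (hħ : ħ ≠ 0) {κ : Measure ℝ}
    [IsProbabilityMeasure κ] {ρ : L2R →L[ℂ] L2R} (hρ : IsNormalState ρ)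
    (hfix : dephasing ħ κ ρ = ρ) : ∀ᵐ p ∂κ, p = 0 := by
  by_contra hκ
  have hρ0 : ρ ≠ 0 := by
    rintro rfl
    simpa [posTrace] using hρ.2
  have heig := hasEigenvalue_norm hρ.isCompactOperator hρ.1 hρ0
  set E := Module.End.eigenspace (ρ : Module.End ℂ L2R) (‖ρ‖ : ℂ)
  have hfin : FiniteDimensional ℂ E :=
    ContinuousLinearMap.finite_dimensional_eigenspace hρ.isCompactOperator _ (by simpa using hρ0)
  have hnt : Nontrivial E := Submodule.nontrivial_iff_ne_bot.2 heig
  let e := Module.finBasis ℂ E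
  -- The exceptional null set depends on the vector; a finite basis of E gives a single one for all
  -- of E.
  have hae : ∀ᵐ p ∂κ, ∀ i, momentumKick ħ (-p) (e i : L2R) ∈ E :=
    ae_all_iff.2 fun i => ae_momentumKick_mem_eigenspace hfix (e i).2
  obtain ⟨p, hp0, hp⟩ := ((not_eventually.1 hκ).and_eventually hae).exists
  have hinv : ∀ ψ ∈ E, (momentumKick ħ (-p)).toLinearMap ψ ∈ E := by
    intro ψ hψ
    have h1 := congrArg (fun v : E => momentumKick ħ (-p) (v : L2R)) (e.sum_repr ⟨ψ, hψ⟩)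
    simp only [AddSubmonoidClass.coe_finsetSum, Submodule.coe_smul, map_sum, map_smul] at h1
    change momentumKick ħ (-p) ψ ∈ E
    rw [← h1]
    exact Submodule.sum_mem _ fun i _ => Submodule.smul_mem _ _ (hp i)
  obtain ⟨c, hc⟩ := Module.End.exists_eigenvalue ((momentumKick ħ (-p)).toLinearMap.restrict hinv)
  obtain ⟨v, hv⟩ := hc.exists_hasEigenvector
  have h2 : momentumKick ħ (-p) (v : L2R) = c • (v : L2R) :=
    congrArg Subtype.val hv.apply_eq_smul
  exact hv.2 (Subtype.ext (eq_zero_of_momentumKick_eq_smul hħ (neg_ne_zero.2 hp0) h2))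

theorem dephasingFunction_eq_one {ħ : ℝ} {κ : Measure ℝ} [IsProbabilityMeasure κ]
    (h : ∀ᵐ p ∂κ, p = 0) (ξ : ℝ) : dephasingFunction ħ κ ξ = 1 := by
  rw [dephasingFunction, integral_congr_ae (g := fun _ => (1 : ℂ))]
  · simp
  · filter_upwards [h] with p hp
    simp [phase, hp]

end QuantumCoherence

end

theorem mainTheorem9 (ħ : ℝ) (hħ : 0 < ħ)
    (κ : MeasureTheory.Measure ℝ) [MeasureTheory.IsProbabilityMeasure κ] :
    (∀ ρ : QuantumCoherence.L2R →L[ℂ] QuantumCoherence.L2R,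
      QuantumCoherence.IsNormalState ρ → 0 ≤ QuantumCoherence.relEntropyLoss ħ κ ρ) ∧
    ((∀ ξ : ℝ, ξ ≠ 0 → ‖QuantumCoherence.dephasingFunction ħ κ ξ‖ < 1) →
      ¬ ∃ ρ : QuantumCoherence.L2R →L[ℂ] QuantumCoherence.L2R,
        QuantumCoherence.IsNormalState ρ ∧ QuantumCoherence.relEntropyLoss ħ κ ρ = 0) := by
  refine ⟨fun ρ hρ => QuantumCoherence.relativeEntropy_nonneg hρ (hρ.dephasing ħ κ), ?_⟩
  rintro hg ⟨ρ, hρ, h0⟩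
  have hfix := QuantumCoherence.eq_of_relativeEntropy_eq_zero hρ (hρ.dephasing ħ κ) h0
  have hκ := QuantumCoherence.ae_eq_zero_of_dephasing_eq_self hħ.ne' hρ hfix
  -- Any ξ ≠ 0 would serve here.
  have h1 := hg 1 one_ne_zero
  rw [QuantumCoherence.dephasingFunction_eq_one hκ, norm_one] at h1
  exact lt_irrefl _ h1
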